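/- Let $\alpha$ be a countable ordinal with $\alpha\ge 3$. For every limit ordinal $\delta\le\alpha$ fix a strictly increasing sequence $(\delta_k)_{k\in\mathbb N}$ cofinal in $\delta$. Let $T_\alpha\subset\mathbb N^{<\omega}$ be the tree, with rank function $\mathrm{rk}$, such that the root $\langle\rangle$ has rank $\alpha$; a node $\sigma$ of limit rank $\delta$ has the children $\sigma^\frown k$, $k\in\mathbb N$, of rank $\delta_k$; a node $\sigma$ of rank $\beta+1$ has the children $\sigma^\frown k$, $k\in\mathbb N$, all of rank $\beta$; and the nodes of rank $0$ are the leaves. Assume that the sequences are chosen so that no $\sigma\in T_\alpha$ of length at most $2$ is a leaf (for instance, every $\delta_k$ is the successor of a successor ordinal). Let $\mathscr L_\alpha$ be the set of leaves. For $x\in 2^{\mathscr L_\alpha}$ let $T^x\colon T_\alpha\to\{0,1\}$ be the unique labelling that extends $x$ and satisfies, for every $\sigma\in T_\alpha\setminus\mathscr L_\alpha$, $T^x(\sigma)=0$ if and only if $T^x(\sigma^\frown k)=1$ for some $k$. Let $\mathbb X_\alpha=2^{\mathscr L_\alpha}\times\mathscr P(\mathbb N)$, with the product topology ($\mathscr P(\mathbb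 N)$ is identified with Cantor space $2^{\mathbb N}$). Let $K_\alpha$ be the directed graph on $\mathbb X_\alpha$ with an edge from $(x,y)$ to $(x',y')$ exactly when $x'=x$, $T^x(\langle\rangle)=0$, and, for the least $n$ with $T^x(\langle n\rangle)=1$, $y\bigtriangleup y'=\{n\}$ and $n\notin y$. For $x\in 2^{\mathscr L_\alpha}$ let $n^x=\sup\{n\in\mathbb N : T^x(\langle m\rangle)=0\text{ for all }m<n\}\in\mathbb N\cup\{\infty\}$, and for $m<n^x$ let $k^x(m)$ be the least $k$ with $T^x(\langle m,k\rangle)=1$. Let $(M_k)_{k\in\mathbb N}$ be a dense sequence in Cantor space. Let $\mathbb W_\alpha$ be the set of all $(x,y)\in\mathbb X_\alpha$ such that for all $m<n^x$, $y{\restriction}(m+1)$ is an initial segment of $M_{k^x(m)}$, with the subspace topology, and let $L_\alpha$ be the restriction of $K_\alpha$ to $\mathbb W_\alpha$. Theorem. There is no countable $\boldsymbol\Sigma^0_\alpha$ colouring of $L_\alpha$; that is, there is no function $c\colon\mathbb W_\alpha\to\mathbb N$ such that $c^{-1}(\{n\})$ is a $\boldsymbol\Sigma^0_\alpha$ subset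 of $\mathbb W_\alpha$ for every $n$, and $c(a)\ne c(b)$ whenever there is an edge of $L_\alpha$ from $a$ to $b$. -/

import Mathlib

open scoped Ordinal

/-! ### The additive Borel classes -/

/-- `SigmaZero ξ A` : the set `A` is in the boldface class `Σ⁰_ξ` of the topological space `X`.
The class `Σ⁰_1` consists of the open sets, and for `ξ > 1` the class `Σ⁰_ξ` consists of the
countable unions of sets whose complements are in `Σ⁰_β` for some `1 ≤ β < ξ`.
(There is no class `Σ⁰_0`, so `1 ≤ β n` and `1 < ξ` are automatic in the second clause.) -/
inductive SigmaZero {X : Type*} [TopologicalSpace X] : Ordinal.{0} → Set X → Prop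
  | ofOpen {U : Set X} : IsOpen U → SigmaZero 1 U
  | iUnion {ξ : Ordinal.{0}} (β : ℕ → Ordinal.{0}) (A : ℕ → Set X) :
      (∀ n, β n < ξ) → (∀ n, SigmaZero (β n) (A n)ᶜ) → SigmaZero ξ (⋃ n, A n)

/-- A countable `Σ⁰_ξ` colouring of a directed graph on a topological space: a map to a countable
set of colours which separates the ends of every edge, and all of whose colour classes
are `Σ⁰_ξ`. -/
def HasCountableSigmaColouring {X : Type*} [TopologicalSpace X] (ξ : Ordinal.{0})
    (G : Digraph X) : Prop :=
  ∃ c : X → ℕ, (∀ a b, G.Adj a b → c a ≠ c b) ∧ ∀ n, SigmaZero ξ (c ⁻¹' {n})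

/-- The restriction of a directed graph to a set of vertices. -/
def Digraph.restrict {X : Type*} (G : Digraph X) (W : Set X) : Digraph W where
  Adj a b := G.Adj a b

/-! ### The tree -/

/-- A choice, for every limit ordinal `δ ≤ α`, of an increasing cofinal sequence in `δ`.
The values of `seq` at other ordinals are irrelevant. -/
structure LadderSystem (α : Ordinal.{0}) where
  seq : Ordinal.{0} → ℕ → Ordinal.{0}
  strictMono : ∀ δ ≤ α, Order.IsSuccLimit δ → StrictMono (seq δ)
  lt : ∀ δ ≤ α, Order.IsSuccLimit δ → ∀ k, seq δ k < δ
  cofinal : ∀ δ ≤ α, Order.IsSuccLimit δ → ∀ β < δ, ∃ k, β ≤ seq δ k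

namespace LadderSystem

variable {α : Ordinal.{0}} (F : LadderSystem α)

open Classical in
/-- The rank of the `k`-th child of a node of rank `β ≠ 0`: it is `β_k` if `β` is a limit, and
`γ` if `β = γ + 1`. -/
noncomputable def childRank (β : Ordinal.{0}) (k : ℕ) : Ordinal.{0} :=
  if Order.IsSuccLimit β then F.seq β k else Ordinal.pred β

/-- The rank of the node `σ`; the root has rank `α`. -/
noncomputable def rank (σ : List ℕ) : Ordinal.{0} := σ.foldl F.childRank α

/-- The tree `T_α`: it contains the root, and all the children `σ ++ [k]` of each of its nodes `σ`
of nonzero rank. -/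
inductive IsNode : List ℕ → Prop
  | root : IsNode []
  | child {σ : List ℕ} (k : ℕ) : IsNode σ → F.rank σ ≠ 0 → IsNode (σ ++ [k])

/-- The set of leaves of `T_α`. -/
def Leaf : Type := {σ : List ℕ // F.IsNode σ ∧ F.rank σ = 0}

theorem rank_append (σ : List ℕ) (k : ℕ) :
    F.rank (σ ++ [k]) = F.childRank (F.rank σ) k := by
  simp [rank, List.foldl_append]

theorem childRank_lt {β : Ordinal.{0}} (hβ : β ≤ α) (h0 : β ≠ 0) (k : ℕ) :
    F.childRank β k < β := by
  unfold childRank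
  split_ifs with h
  · exact F.lt β hβ h k
  · rw [Ordinal.pred_lt_iff_not_isSuccPrelimit]
    intro h'
    exact h ⟨by simpa using h0, h'⟩

theorem childRank_le {β : Ordinal.{0}} (hβ : β ≤ α) (k : ℕ) : F.childRank β k ≤ β := by
  by_cases h0 : β = 0
  · subst h0
    simp [childRank]
  · exact (F.childRank_lt hβ h0 k).le

theorem rank_le (σ : List ℕ) : F.rank σ ≤ α := by
  induction σ using List.reverseRecOn with
  | nil => exact le_rfl
  | append_singleton σ k ih =>
    rw [rank_append]
    exact (F.childRank_le ih k).trans ih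

theorem rank_child_lt {σ : List ℕ} (h : F.rank σ ≠ 0) (k : ℕ) :
    F.rank (σ ++ [k]) < F.rank σ := by
  rw [rank_append]
  exact F.childRank_lt (F.rank_le σ) h k

open Classical in
/-- The labelling `T^x` of the tree determined by a labelling `x` of its leaves, with `false` and
`true` for the labels `0` and `1`. At a leaf it agrees with `x`, and a node which is not a leaf
has label `1` exactly if all its children have label `0`. (The value at a sequence outside the
tree is irrelevant.) -/
noncomputable def label (x : F.Leaf → Bool) (σ : List ℕ) : Bool :=
  if h : F.rank σ = 0 then
    if h' : F.IsNode σ then x ⟨σ, h', h⟩ else false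
  else decide (∀ k : ℕ, label x (σ ++ [k]) = false)
termination_by F.rank σ
decreasing_by exact F.rank_child_lt h k

theorem label_leaf (x : F.Leaf → Bool) (σ : F.Leaf) : F.label x σ.1 = x σ := by
  rw [label, dif_pos σ.2.2, dif_pos σ.2.1]
  rfl

theorem label_eq_false_iff (x : F.Leaf → Bool) {σ : List ℕ} (h : F.rank σ ≠ 0) :
    F.label x σ = false ↔ ∃ k : ℕ, F.label x (σ ++ [k]) = true := by
  rw [label, dif_neg h]
  simp

/-! ### The graphs -/

/-- The space `𝕏_α = 2^Leaf × 2^ℕ`, with the product topology. A point `y` of the second factor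
stands for the set `{n | y n = true}`. -/
abbrev Point : Type := (F.Leaf → Bool) × (ℕ → Bool)

/-- The directed graph `K_α`: there is an edge from `(x, y)` to `(x', y')` if `x' = x`, the root
has label `0` in `T^x`, and for the least `n` with `T^x(⟨n⟩) = 1` we have `y ∆ y' = {n}`
and `n ∉ y`. -/
def graphK : Digraph F.Point where
  Adj p q := q.1 = p.1 ∧ F.label p.1 [] = false ∧
    ∃ n : ℕ, IsLeast {n | F.label p.1 [n] = true} n ∧
      symmDiff {i | p.2 i = true} {i | q.2 i = true} = {n} ∧ n ∉ {i | p.2 i = true}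

/-- The number `n^x ∈ ℕ ∪ {∞}`, the supremum of all `n` such that `T^x(⟨m⟩) = 0` for all
`m < n`. -/
noncomputable def nx (x : F.Leaf → Bool) : ℕ∞ :=
  ⨆ n ∈ {n : ℕ | ∀ m < n, F.label x [m] = false}, (n : ℕ∞)

/-- The number `k^x(m)`, the least `k` with `T^x(⟨m, k⟩) = 1`; it is used only for `m < n^x`. -/
noncomputable def kx (x : F.Leaf → Bool) (m : ℕ) : ℕ :=
  sInf {k : ℕ | F.label x [m, k] = true}

/-- The set `𝕎_α` of the points `(x, y)` such that, for all `m < n^x`, the string `y ↾ (m + 1)` is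
an initial segment of `M_k` for `k = k^x(m)`. -/
def setW (M : ℕ → ℕ → Bool) : Set F.Point :=
  {p | ∀ m : ℕ, (m : ℕ∞) < F.nx p.1 → ∀ i < m + 1, p.2 i = M (F.kx p.1 m) i}

/-- The directed graph `L_α`, the restriction of `K_α` to `𝕎_α`. -/
def graphL (M : ℕ → ℕ → Bool) : Digraph (F.setW M) := F.graphK.restrict (F.setW M)

end LadderSystem

open Topology Filter Set

/-! ### Generalities on the additive Borel classes and on Baire category -/

/-! The graph is pulled back to total labellings of `ℕ^{<ω}` that obey the labelling rule
everywhere, even at leaves of `T_α`, through sequences beyond the tree. Those with `T ⟨m⟩ = 0`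
exactly for `m ∈ S` form a Gδ, hence Baire, space `coherentPoints J M S`. For `S = univ` the root
has label 1 and there are no edges; for `S = Iio n` the points `z` and `flip n z` are always joined
by an edge.

Given a colouring, category in the `univ` space yields a piece of a colour class, with `Σ⁰_β`
complement for some `β < α`, that is comeager in a cylinder around a point `z`. The retagging
argument `forcesOn_transfers` carries this to the space of `Iio n`: only the level-`β` part
`Transfers β` of the cylinder is needed. If `n` is the length of the cylinder, this part says
nothing about `y n`, so `flip n` preserves it. A generic point of it and its flip then have the same
colour, a contradiction.

`forcesOn_transfers` is an induction on the Borel level in which the spaces of `univ` and `Iio n`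
change roles at each step. Its core is `exists_amalgam`: finite information about `z` and
lower-level information about `w` hold together at a point in the space of `z`. Density of `M`
supplies arbitrarily late first witnesses `k^x(m)` compatible with a given `y`, and `J` rules out
witnesses of low rank. -/

theorem SigmaZero.preimage {X Y : Type*} [TopologicalSpace X] [TopologicalSpace Y]
    {f : X → Y} (hf : Continuous f) {ξ : Ordinal.{0}} {A : Set Y} (hA : SigmaZero ξ A) :
    SigmaZero ξ (f ⁻¹' A) := by
  induction hA with
  | ofOpen hU => exact .ofOpen (hU.preimage hf)
  | iUnion β A hβ _ ih =>
    rw [preimage_iUnion]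
    exact .iUnion β _ hβ ih

theorem SigmaZero.exists_preimage_val {X : Type*} [TopologicalSpace X] {W : Set X}
    {ξ : Ordinal.{0}} {A : Set W} (hA : SigmaZero ξ A) :
    ∃ B : Set X, SigmaZero ξ B ∧ Subtype.val ⁻¹' B = A := by
  induction hA with
  | ofOpen hU =>
    obtain ⟨V, hV, rfl⟩ := isOpen_induced_iff.1 hU
    exact ⟨V, .ofOpen hV, rfl⟩
  | iUnion β A hβ _ ih =>
    choose B hB hBA using ih
    refine ⟨⋃ n, (B n)ᶜ, .iUnion β _ hβ fun n => by rw [compl_compl]; exact hB n, ?_⟩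
    simp [preimage_iUnion, hBA]

theorem SigmaZero.baireMeasurableSet {X : Type*} [TopologicalSpace X] {ξ : Ordinal.{0}}
    {A : Set X} (hA : SigmaZero ξ A) : BaireMeasurableSet A := by
  induction hA with
  | ofOpen hU => exact hU.baireMeasurableSet
  | iUnion β A _ _ ih => exact .iUnion fun n => (ih n).of_compl

/-- `ForcesOn Y U D`: the set `D` is comeager in the trace of `U` on the subspace `Y`. -/
def ForcesOn {Z : Type*} [TopologicalSpace Z] (Y U D : Set Z) : Prop :=
  ∀ᶠ z : Y in residual Y, (z : Z) ∈ U → (z : Z) ∈ D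

namespace ForcesOn

variable {Z : Type*} [TopologicalSpace Z] {Y U V D E : Set Z}

theorem mono_left (h : ForcesOn Y U D) (hV : V ∩ Y ⊆ U) : ForcesOn Y V D :=
  h.mono fun z hz hzV => hz (hV ⟨hzV, z.2⟩)

theorem exists_mem_inter [BaireSpace Y] (hD : ForcesOn Y U D) (hE : ForcesOn Y U E)
    (hU : IsOpen U) (hne : (U ∩ Y).Nonempty) : ∃ z ∈ Y, z ∈ U ∧ z ∈ D ∧ z ∈ E := by
  have hd := dense_of_mem_residual (hD.and hE)
  obtain ⟨x, hxU, hxY⟩ := hne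
  obtain ⟨z, hz, hz'⟩ := hd.inter_open_nonempty (Subtype.val ⁻¹' U)
    (hU.preimage continuous_subtype_val) ⟨⟨x, hxY⟩, hxU⟩
  exact ⟨z, z.2, hz, hz'.1 hz, hz'.2 hz⟩

theorem exists_not_of_not_iInter {A : ℕ → Set Z} (h : ¬ ForcesOn Y U (⋂ n, A n)) :
    ∃ n, ¬ ForcesOn Y U (A n) := by
  by_contra! h'
  refine h ?_
  filter_upwards [eventually_countable_forall.2 h'] with z hz hzU
  exact mem_iInter.2 fun n => hz n hzU

/-- Localisation: modulo a meager set, `D` is open in `Y`, and that open set meets `U` because `D`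
is not meager there. -/
theorem exists_open_of_not_compl (hU : IsOpen U)
    (hD : BaireMeasurableSet (Subtype.val ⁻¹' D : Set Y)) (h : ¬ ForcesOn Y U Dᶜ) :
    ∃ V ⊆ U, IsOpen V ∧ (V ∩ Y).Nonempty ∧ ForcesOn Y V D := by
  obtain ⟨G, hG, hDG⟩ := hD.residualEq_isOpen
  obtain ⟨G, hG', rfl⟩ := isOpen_induced_iff.1 hG
  have hiff : ∀ᶠ z : Y in residual Y, (z : Z) ∈ D ↔ (z : Z) ∈ G := hDG.mem_iff
  refine ⟨U ∩ G, inter_subset_left, hU.inter hG', ?_, ?_⟩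
  · by_contra hne
    refine h ?_
    filter_upwards [hiff] with z hz hzU hzD
    exact hne ⟨z, ⟨hzU, hz.1 hzD⟩, z.2⟩
  · filter_upwards [hiff] with z hz hzU
    exact hz.2 hzU.2

theorem preimage_of_involutive {f : Z → Z} (h : ForcesOn Y U D) (hf : Continuous f)
    (hinv : Function.Involutive f) (hmaps : MapsTo f Y Y) : ForcesOn Y (f ⁻¹' U) (f ⁻¹' D) := by
  have hfY : Continuous (hmaps.restrict f Y Y) := hf.restrict hmaps
  have hinvY : Function.Involutive (hmaps.restrict f Y Y) := fun z => Subtype.ext (hinv z)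
  let e : Y ≃ₜ Y := ⟨hinvY.toPerm, hfY, hfY⟩
  have : Tendsto e (residual Y) (residual Y) := e.residual_map_eq.le
  exact this.eventually h

end ForcesOn

/-! ### Total labellings of the tree of all finite sequences -/

section Kernel

variable (P₁ P₀ : Set (List ℕ))

open Classical in
/-- The greedy labelling, on reversed sequences, with prescribed values `1` on `P₁` and `0` on
`P₀`. -/
noncomputable def greedyRev : List ℕ → Bool
  | [] => decide ([] ∈ P₁ ∨ ([] ∉ P₀ ∧ ∀ j : ℕ, [j] ∉ P₁))
  | k :: l => decide (l.reverse ++ [k] ∈ P₁ ∨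
      (l.reverse ++ [k] ∉ P₀ ∧ greedyRev l = false ∧ ∀ j : ℕ, l.reverse ++ [k] ++ [j] ∉ P₁))

variable {P₁ P₀}

/-- Labels are chosen from the root outwards: a sequence without prescription gets 1 exactly if its
parent (if any) has 0 and no child is prescribed 1. Then no two neighbours have label 1, and `hw`
provides each sequence of label 0 with a child of label 1. -/
theorem exists_labelling_extending (hd : ∀ σ ∈ P₁, σ ∉ P₀)
    (hi : ∀ σ ∈ P₁, ∀ k : ℕ, σ ++ [k] ∉ P₁)
    (hw : ∀ σ ∉ P₁, ∃ k : ℕ, σ ++ [k] ∈ P₁ ∨ (σ ++ [k] ∉ P₀ ∧ ∀ j : ℕ, σ ++ [k] ++ [j] ∉ P₁)) :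
    ∃ T : List ℕ → Bool, (∀ σ, T σ = true ↔ ∀ k : ℕ, T (σ ++ [k]) = false) ∧
      (∀ σ ∈ P₁, T σ = true) ∧ ∀ σ ∈ P₀, T σ = false := by
  have hsnoc : ∀ (σ : List ℕ) (k : ℕ), greedyRev P₁ P₀ (σ ++ [k]).reverse = true ↔
      (σ ++ [k] ∈ P₁ ∨ (σ ++ [k] ∉ P₀ ∧ greedyRev P₁ P₀ σ.reverse = false ∧
        ∀ j : ℕ, σ ++ [k] ++ [j] ∉ P₁)) := by
    intro σ k
    simp [greedyRev]
  have hone : ∀ σ ∈ P₁, greedyRev P₁ P₀ σ.reverse = true := by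
    intro σ hσ
    cases σ using List.reverseRecOn with
    | nil => simp [greedyRev, hσ]
    | append_singleton σ k => exact (hsnoc σ k).2 (Or.inl hσ)
  have hchild : ∀ σ, greedyRev P₁ P₀ σ.reverse = true → σ ∉ P₁ → ∀ j : ℕ, σ ++ [j] ∉ P₁ := by
    intro σ hσ hσ'
    cases σ using List.reverseRecOn with
    | nil =>
      have := hσ
      simp only [List.reverse_nil, greedyRev, decide_eq_true_eq] at this
      exact (this.resolve_left hσ').2
    | append_singleton σ k => exact (((hsnoc σ k).1 hσ).resolve_left hσ').2.2
  refine ⟨fun σ => greedyRev P₁ P₀ σ.reverse, fun σ => ⟨fun h k => ?_, fun h => ?_⟩, hone, ?_⟩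
  · by_contra hk
    rw [Bool.not_eq_false, hsnoc] at hk
    rcases hk with hk | ⟨-, hk, -⟩
    · by_cases hσ : σ ∈ P₁
      · exact hi σ hσ k hk
      · exact hchild σ h hσ k hk
    · simp [h] at hk
  · by_contra hσ
    obtain ⟨k, hk⟩ := hw σ fun hσ' => hσ (hone σ hσ')
    have : greedyRev P₁ P₀ (σ ++ [k]).reverse = true := by
      rw [hsnoc]
      rcases hk with hk | hk
      · exact Or.inl hk
      · exact Or.inr ⟨hk.1, by simpa using hσ, hk.2⟩
    exact absurd (this.symm.trans (h k)) (by simp)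
  · intro σ hσ
    have hσ' : σ ∉ P₁ := fun h => hd σ h hσ
    cases σ using List.reverseRecOn with
    | nil => simp [greedyRev, hσ, hσ']
    | append_singleton σ k =>
      by_contra h
      rw [Bool.not_eq_false, hsnoc] at h
      exact (h.resolve_left hσ').1 hσ

end Kernel

/-- A dense sequence in Cantor space extends every finite string at arbitrarily large indices. -/
theorem DenseRange.exists_ge_eqOn {M : ℕ → ℕ → Bool} (hM : DenseRange M) (y : ℕ → Bool)
    (m N : ℕ) : ∃ k ≥ N, ∀ i ≤ m, y i = M k i := by
  -- Past `m` the point diagonalises against `M 0, M 1, …`, so agreement up to `m + N` excludes the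
  -- indices below `N`.
  let y' : ℕ → Bool := fun i => if i ≤ m then y i else !M (i - (m + 1)) i
  have hO : IsOpen {x : ℕ → Bool | ∀ i ∈ Finset.range (m + 1 + N), x i = y' i} := by
    have : {x : ℕ → Bool | ∀ i ∈ Finset.range (m + 1 + N), x i = y' i} =
        ⋂ i ∈ Finset.range (m + 1 + N), {x : ℕ → Bool | x i = y' i} := by
      ext x; simp
    rw [this]
    refine isOpen_biInter_finset fun i _ => ?_
    exact (isOpen_discrete ({y' i} : Set Bool)).preimage
      (continuous_apply (A := fun _ : ℕ => Bool) i)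
  obtain ⟨k, hk⟩ := hM.exists_mem_open hO ⟨y', fun _ _ => rfl⟩
  refine ⟨k, ?_, fun i hi => ?_⟩
  · by_contra! hkN
    have := hk (m + 1 + k) (Finset.mem_range.2 (by omega))
    simp [y', show ¬ (m + 1 + k ≤ m) by omega] at this
  · have := hk i (Finset.mem_range.2 (by omega))
    simp [this, y', hi]

/-! ### The Baire spaces of coherent labelled points -/

/-- The space of pairs of a labelling of all finite sequences and a point of Cantor space. -/
abbrev LabelledPoint : Type := (List ℕ → Bool) × (ℕ → Bool)

/-- The labelled points for which the labelling `T` is consistent at every sequence, `T ⟨m⟩ = 0`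
exactly for `m ∈ S`, `T ⟨m, j⟩ = 0` for all `j < J m`, and if `k` is the least number with
`T ⟨m, k⟩ = 1`, then the point of Cantor space agrees with `M k` up to `m`. -/
def coherentPoints (J : ℕ → ℕ) (M : ℕ → ℕ → Bool) (S : Set ℕ) : Set LabelledPoint :=
  {z | (∀ σ, z.1 σ = true ↔ ∀ k : ℕ, z.1 (σ ++ [k]) = false) ∧
    (∀ m : ℕ, z.1 [m] = false ↔ m ∈ S) ∧
    (∀ m : ℕ, ∀ j < J m, z.1 [m, j] = false) ∧
    ∀ m k : ℕ, z.1 [m, k] = true → (∀ j < k, z.1 [m, j] = false) → ∀ i ≤ m, z.2 i = M k i}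

theorem isClopen_setOf_fst_eq (σ : List ℕ) (b : Bool) :
    IsClopen {z : LabelledPoint | z.1 σ = b} :=
  (isClopen_discrete {b}).preimage ((continuous_apply σ).comp continuous_fst)

theorem isClopen_setOf_snd_eq (i : ℕ) (b : Bool) :
    IsClopen {z : LabelledPoint | z.2 i = b} :=
  (isClopen_discrete {b}).preimage ((continuous_apply i).comp continuous_snd)

/-- Only the demand that each label 0 has a child of label 1 fails to be closed; it is one open
condition for each of countably many sequences. -/
theorem isGδ_coherentPoints (J : ℕ → ℕ) (M : ℕ → ℕ → Bool) (S : Set ℕ) :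
    IsGδ (coherentPoints J M S) := by
  have h : coherentPoints J M S =
      (⋂ σ, {z : LabelledPoint | z.1 σ = true ∨ ∃ k : ℕ, z.1 (σ ++ [k]) = true}) ∩
      {z : LabelledPoint | (∀ σ, ∀ k : ℕ, z.1 σ = false ∨ z.1 (σ ++ [k]) = false) ∧
        (∀ m : ℕ, z.1 [m] = false ↔ m ∈ S) ∧
        (∀ m : ℕ, ∀ j < J m, z.1 [m, j] = false) ∧
        ∀ m k : ℕ, z.1 [m, k] = true → (∀ j < k, z.1 [m, j] = false) →
          ∀ i ≤ m, z.2 i = M k i} := by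
    ext z
    simp only [coherentPoints, mem_ofPred_eq, mem_inter_iff, mem_iInter, ← and_assoc]
    refine and_congr_left fun _ => and_congr_left fun _ => and_congr_left fun _ =>
      ⟨fun h => ⟨fun σ => ?_, fun σ k => ?_⟩, fun h σ => ⟨fun hσ k => ?_, fun hσ => ?_⟩⟩
    · by_contra! hc
      exact hc.1 ((h σ).2 fun k => by simpa using hc.2 k)
    · by_contra! hc
      exact hc.2 ((h σ).1 (by simpa using hc.1) k)
    · simpa [hσ] using h.2 σ k
    · simpa [hσ] using h.1 σ
  rw [h]
  refine (IsGδ.iInter_of_isOpen fun σ => ?_).inter (IsClosed.isGδ ?_)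
  · simp only [ofPred_or, ofPred_exists]
    exact (isClopen_setOf_fst_eq _ _).isOpen.union
      (isOpen_iUnion fun k => (isClopen_setOf_fst_eq _ _).isOpen)
  · simp only [ofPred_and, ofPred_forall]
    refine .inter ?_ (.inter ?_ (.inter ?_ ?_))
    · refine isClosed_iInter fun σ => isClosed_iInter fun k => ?_
      exact (isClopen_setOf_fst_eq _ _).isClosed.union (isClopen_setOf_fst_eq _ _).isClosed
    · refine isClosed_iInter fun m => ?_
      by_cases hm : m ∈ S
      · simpa [hm] using (isClopen_setOf_fst_eq [m] false).isClosed
      · simpa [hm] using (isClopen_setOf_fst_eq [m] true).isClosed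
    · exact isClosed_iInter fun m => isClosed_iInter fun j => isClosed_iInter fun _ =>
        (isClopen_setOf_fst_eq _ _).isClosed
    · refine isClosed_iInter fun m => isClosed_iInter fun k => ?_
      have : {z : LabelledPoint | z.1 [m, k] = true → (∀ j < k, z.1 [m, j] = false) →
          ∀ i ≤ m, z.2 i = M k i} = {z : LabelledPoint | z.1 [m, k] = false} ∪
          ((⋃ j ∈ Finset.range k, {z : LabelledPoint | z.1 [m, j] = true}) ∪
          ⋂ i ≤ m, {z : LabelledPoint | z.2 i = M k i}) := by
        ext z
        simp only [mem_ofPred_eq, mem_union, mem_iUnion, mem_iInter, Finset.mem_range]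
        constructor
        · intro h
          by_contra! hc
          obtain ⟨h₁, h₂, i, hi, h₃⟩ := hc
          exact h₃ (h (by simpa using h₁) (fun j hj => by simpa using h₂ j hj) i hi)
        · rintro (h | ⟨j, hj, h⟩ | h) h₁ h₂
          · simp [h] at h₁
          · simp [h₂ j hj] at h
          · exact h
      rw [this]
      exact (isClopen_setOf_fst_eq _ _).isClosed.union
        ((isClosed_biUnion_finset fun j _ => (isClopen_setOf_fst_eq _ _).isClosed).union
          (isClosed_iInter fun i => isClosed_iInter fun _ => (isClopen_setOf_snd_eq _ _).isClosed))

instance baireSpace_coherentPoints (J : ℕ → ℕ) (M : ℕ → ℕ → Bool) (S : Set ℕ) :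
    BaireSpace (coherentPoints J M S) :=
  (isGδ_coherentPoints J M S).baireSpace_of_t2Space_locallyCompactSpace

theorem finite_setOf_append_mem {Q : Set (List ℕ)} (hQ : Q.Finite) (σ : List ℕ) :
    {k : ℕ | ∃ τ, σ ++ k :: τ ∈ Q}.Finite := by
  refine (hQ.image fun τ => τ.getD σ.length 0).subset ?_
  rintro k ⟨τ, hτ⟩
  exact ⟨_, hτ, by simp⟩

/-- Realisation of prescribed labels at sequences of length at least two. -/
theorem exists_coherentPoint {J : ℕ → ℕ} {M : ℕ → ℕ → Bool} (hM : DenseRange M) {S : Set ℕ}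
    {Q₁ Q₀ : Set (List ℕ)} (y : ℕ → Bool)
    (h₁ : ∀ σ ∈ Q₁, 2 ≤ σ.length) (hd : ∀ σ ∈ Q₁, σ ∉ Q₀)
    (hi : ∀ σ ∈ Q₁, ∀ k : ℕ, σ ++ [k] ∉ Q₁) (hfin₁ : Q₁.Finite)
    (hfin₀ : ∀ σ, 1 ≤ σ.length → σ ∉ Q₁ → {k : ℕ | σ ++ [k] ∈ Q₀}.Finite)
    (hS : ∀ m j : ℕ, [m, j] ∈ Q₁ → m ∈ S)
    (hk : ∀ m ∈ S, (∃ k : ℕ, [m, k] ∈ Q₁ ∧ (∀ j < k, [m, j] ∈ Q₀) ∧ J m ≤ k ∧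
      ∀ i ≤ m, y i = M k i) ∨ ∀ j : ℕ, [m, j] ∉ Q₁) :
    ∃ z ∈ coherentPoints J M S, z.2 = y ∧ (∀ σ ∈ Q₁, z.1 σ = true) ∧
      ∀ σ ∈ Q₀, 2 ≤ σ.length → z.1 σ = false := by
  -- `κ m` will be the first witness for `T ⟨m⟩ = 0`: the prescribed one if there is one, and
  -- otherwise an index from density of `M`, beyond `J m` and all prescriptions below `⟨m⟩`.
  have hκ : ∀ m, ∃ κ : ℕ, m ∈ S → J m ≤ κ ∧ (∀ i ≤ m, y i = M κ i) ∧ [m, κ] ∉ Q₀ ∧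
      (∀ j : ℕ, [m, κ, j] ∉ Q₁) ∧ ∀ j < κ, [m, j] ∉ Q₁ := by
    intro m
    by_cases hm : m ∈ S
    swap
    · exact ⟨0, fun h => absurd h hm⟩
    rcases hk m hm with ⟨k, hk₁, hk₂, hk₃, hk₄⟩ | h
    · exact ⟨k, fun _ => ⟨hk₃, hk₄, hd _ hk₁, fun j => hi _ hk₁ j,
        fun j hj hj' => hd _ hj' (hk₂ j hj)⟩⟩
    · have hf : ({k : ℕ | [m] ++ [k] ∈ Q₀} ∪ {k : ℕ | ∃ τ, [m] ++ k :: τ ∈ Q₁}).Finite :=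
        (hfin₀ [m] le_rfl fun h => by simpa using h₁ _ h).union (finite_setOf_append_mem hfin₁ _)
      obtain ⟨b, hb⟩ := hf.bddAbove
      obtain ⟨k, hkN, hky⟩ := hM.exists_ge_eqOn y m (max (J m) (b + 1))
      have hkb : k ∉ ({k : ℕ | [m] ++ [k] ∈ Q₀} ∪ {k : ℕ | ∃ τ, [m] ++ k :: τ ∈ Q₁}) := by
        intro hk'
        have := hb hk'
        omega
      simp only [mem_union, mem_ofPred_eq, not_or, not_exists, List.singleton_append] at hkb
      exact ⟨k, fun _ => ⟨by omega, hky, hkb.1, fun j => hkb.2 [j], fun j _ => h j⟩⟩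
  choose κ hκ using hκ
  -- At lengths 0 and 1 the labels are dictated by `S`; at length 2 the first witnesses join the
  -- prescriptions.
  let P₁ : Set (List ℕ) := {σ | match σ with
    | [] => S = univ
    | [m] => m ∉ S
    | [m, j] => [m, j] ∈ Q₁ ∨ (m ∈ S ∧ j = κ m)
    | σ => σ ∈ Q₁}
  let P₀ : Set (List ℕ) := {σ | match σ with
    | [] => S ≠ univ
    | [m] => m ∈ S
    | [m, j] => [m, j] ∈ Q₀ ∨ (m ∈ S ∧ j < κ m)
    | σ => σ ∈ Q₀}
  have hQP : ∀ σ ∈ Q₁, σ ∈ P₁ := by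
    intro σ hσ
    match σ with
    | [] => simpa using h₁ _ hσ
    | [m] => simpa using h₁ _ hσ
    | [m, j] => exact Or.inl hσ
    | a :: b :: c :: l => exact hσ
  have hlong : ∀ σ : List ℕ, 2 ≤ σ.length → σ ∉ Q₁ →
      ∃ k : ℕ, σ ++ [k] ∉ Q₀ ∧ ∀ j : ℕ, σ ++ [k] ++ [j] ∉ Q₁ := by
    intro σ hσ hσ'
    obtain ⟨k, hk⟩ := ((hfin₀ σ (by omega) hσ').union
      (finite_setOf_append_mem hfin₁ σ)).exists_notMem
    simp only [mem_union, mem_ofPred_eq, not_or, not_exists] at hk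
    exact ⟨k, hk.1, fun j => by simpa using hk.2 [j]⟩
  obtain ⟨T, hT, hT₁, hT₀⟩ := exists_labelling_extending (P₁ := P₁) (P₀ := P₀) (by
      intro σ hσ hσ'
      match σ, hσ, hσ' with
      | [], hσ, hσ' => exact hσ' hσ
      | [m], hσ, hσ' => exact hσ hσ'
      | [m, j], hσ, hσ' =>
        rcases hσ with hσ | ⟨hm, rfl⟩
        · rcases hσ' with hσ' | ⟨hm, hj⟩
          · exact hd _ hσ hσ'
          · exact (hκ m hm).2.2.2.2 j hj hσ
        · rcases hσ' with hσ' | ⟨-, hj⟩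
          · exact (hκ m hm).2.2.1 hσ'
          · exact hj.false
      | a :: b :: c :: l, hσ, hσ' => exact hd _ hσ hσ') (by
      intro σ hσ k hσ'
      match σ, hσ, hσ' with
      | [], hσ, hσ' => exact hσ' ((hσ : S = univ) ▸ mem_univ k)
      | [m], hσ, hσ' =>
        rcases hσ' with hσ' | ⟨hm, -⟩
        · exact hσ (hS _ _ hσ')
        · exact hσ hm
      | [m, j], hσ, hσ' =>
        rcases hσ with hσ | ⟨hm, rfl⟩
        · exact hi _ hσ k hσ'
        · exact (hκ m hm).2.2.2.1 k hσ'
      | a :: b :: c :: l, hσ, hσ' => exact hi _ hσ k hσ') (by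
      intro σ hσ
      match σ, hσ with
      | [], hσ =>
        obtain ⟨m, hm⟩ := (ne_univ_iff_exists_notMem S).1 hσ
        exact ⟨m, Or.inl hm⟩
      | [m], hσ =>
        have hm : m ∈ S := not_not.1 hσ
        exact ⟨κ m, Or.inl (Or.inr ⟨hm, rfl⟩)⟩
      | [m, j], hσ =>
        obtain ⟨k, hk₀, hk₁⟩ := hlong [m, j] (by simp) fun h => hσ (Or.inl h)
        exact ⟨k, Or.inr ⟨hk₀, hk₁⟩⟩
      | a :: b :: c :: l, hσ =>
        obtain ⟨k, hk₀, hk₁⟩ := hlong (a :: b :: c :: l) (by simp) hσ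
        exact ⟨k, Or.inr ⟨hk₀, hk₁⟩⟩)
  have hTm : ∀ m : ℕ, T [m] = false ↔ m ∈ S := by
    refine fun m => ⟨fun h => ?_, fun h => hT₀ [m] h⟩
    by_contra hm
    simp [hT₁ [m] hm] at h
  refine ⟨(T, y), ⟨hT, hTm, fun m j hj => ?_, fun m k hmk hj => ?_⟩, rfl,
    fun σ hσ => hT₁ σ (hQP σ hσ), fun σ hσ hl => hT₀ σ ?_⟩
  · by_cases hm : m ∈ S
    · exact hT₀ [m, j] (Or.inr ⟨hm, hj.trans_le (hκ m hm).1⟩)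
    · exact (hT [m]).1 (hT₁ [m] hm) j
  · have hm : m ∈ S := by
      by_contra hm
      exact absurd (hmk.symm.trans ((hT [m]).1 (hT₁ [m] hm) k)) (by simp)
    have hkκ : k = κ m := by
      rcases lt_trichotomy k (κ m) with h | h | h
      · have : T [m, k] = false := hT₀ [m, k] (Or.inr ⟨hm, h⟩)
        simp_all
      · exact h
      · have h1 : T [m, κ m] = true := hT₁ [m, κ m] (Or.inr ⟨hm, rfl⟩)
        have h2 := hj (κ m) h
        simp_all
    subst hkκ
    exact (hκ m hm).2.1
  · match σ, hl with
    | [m, j], _ => exact Or.inl hσ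
    | a :: b :: c :: l, _ => exact hσ

/-! ### Ranks of late children -/

namespace LadderSystem

section Ranks

variable {α : Ordinal.{0}} (F : LadderSystem α)

theorem exists_le_childRank {β γ : Ordinal.{0}} (hβ : β ≤ α) (hγ : γ < β) :
    ∃ K : ℕ, ∀ k ≥ K, γ ≤ F.childRank β k := by
  by_cases h : Order.IsSuccLimit β
  · obtain ⟨K, hK⟩ := F.cofinal β hβ h γ hγ
    refine ⟨K, fun k hk => ?_⟩
    rw [childRank, if_pos h]
    exact hK.trans ((F.strictMono β hβ h).monotone hk)
  · refine ⟨0, fun k _ => ?_⟩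
    rw [childRank, if_neg h]
    have h' : ¬ Order.IsSuccPrelimit β := fun hp =>
      h ⟨by simpa using (zero_le.trans_lt hγ).ne', hp⟩
    obtain ⟨δ, rfl⟩ := Order.not_isSuccPrelimit_iff_mem_range_succ.1 h'
    simpa using Order.lt_succ_iff.1 hγ

theorem exists_le_rank_child {σ : List ℕ} {γ : Ordinal.{0}} (hγ : γ < F.rank σ) :
    ∃ K : ℕ, ∀ k ≥ K, γ ≤ F.rank (σ ++ [k]) := by
  simpa only [rank_append] using F.exists_le_childRank (F.rank_le σ) hγ

theorem finite_rank_child_lt {σ : List ℕ} {γ : Ordinal.{0}} (hγ : γ < F.rank σ) :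
    {k : ℕ | F.rank (σ ++ [k]) < γ}.Finite := by
  obtain ⟨K, hK⟩ := F.exists_le_rank_child hγ
  refine (finite_lt_nat K).subset fun k hk => ?_
  by_contra h
  exact absurd (hK k (not_lt.1 h)) (not_le.2 hk)

/-- One `J` has to serve every `γ`, since it is part of the spaces and stays fixed during the
induction on the Borel level. The successor in the hypothesis leaves room for descending two levels
of the tree. -/
theorem exists_uniform_le_rank : ∃ J : ℕ → ℕ, ∀ γ : Ordinal.{0},
    Order.succ γ < α → ∃ N : ℕ, ∀ m ≥ N, ∀ j ≥ J m, γ ≤ F.rank [m, j] := by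
  by_cases h : Order.IsSuccLimit α
  · have hr : ∀ m : ℕ, F.rank [m] = F.seq α m := fun m => by simp [rank, childRank, h]
    have hmono := F.strictMono α le_rfl h
    -- The rank of `⟨m⟩` is `α_m`, so late children reach the smaller value `α_{m-1}`, and these
    -- values are cofinal in `α`.
    have : ∀ m : ℕ, ∃ K : ℕ, m ≠ 0 → ∀ j ≥ K, F.seq α (m - 1) ≤ F.rank [m, j] := by
      intro m
      by_cases hm : m = 0
      · exact ⟨0, fun h => absurd hm h⟩
      · obtain ⟨K, hK⟩ := F.exists_le_rank_child (σ := [m]) (γ := F.seq α (m - 1))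
          (by rw [hr]; exact hmono (by omega))
        exact ⟨K, fun _ => hK⟩
    choose J hJ using this
    refine ⟨J, fun γ hγ => ?_⟩
    obtain ⟨N, hN⟩ := F.cofinal α le_rfl h γ ((Order.le_succ γ).trans_lt hγ)
    refine ⟨N + 1, fun m hm j hj => hN.trans ?_⟩
    exact (hmono.monotone (by omega)).trans (hJ m (by omega) j hj)
  · have hr : ∀ m : ℕ, F.rank [m] = F.rank [0] := fun m => by simp [rank, childRank, h]
    -- All `⟨m⟩` have the same rank here, so any `J` tending to infinity works.
    refine ⟨fun m => m, fun γ hγ => ?_⟩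
    have hγ' : γ < F.rank [0] := by
      obtain ⟨K, hK⟩ := F.exists_le_childRank le_rfl hγ
      exact Order.succ_le_iff.1 ((hK K le_rfl).trans_eq (hr K))
    obtain ⟨K, hK⟩ := F.exists_le_childRank (F.rank_le [0]) hγ'
    refine ⟨K, fun m hm j hj => ?_⟩
    have := hK j (hm.le.trans hj)
    rw [← hr m] at this
    exact this

end Ranks

/-! ### Finite information about labelled points -/

/-- The points that agree with `z` on the labels in `A` and on the first `ℓ` coordinates. -/
def cylinder (A : Finset (List ℕ)) (ℓ : ℕ) (z : LabelledPoint) : Set LabelledPoint :=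
  {w | (∀ σ ∈ A, w.1 σ = z.1 σ) ∧ ∀ i < ℓ, w.2 i = z.2 i}

theorem isOpen_cylinder (A : Finset (List ℕ)) (ℓ : ℕ) (z : LabelledPoint) :
    IsOpen (cylinder A ℓ z) := by
  have : cylinder A ℓ z = (⋂ σ ∈ A, {w : LabelledPoint | w.1 σ = z.1 σ}) ∩
      ⋂ i ∈ Finset.range ℓ, {w : LabelledPoint | w.2 i = z.2 i} := by
    ext w; simp [cylinder]
  rw [this]
  exact (isOpen_biInter_finset fun σ _ => (isClopen_setOf_fst_eq _ _).isOpen).inter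
    (isOpen_biInter_finset fun i _ => (isClopen_setOf_snd_eq _ _).isOpen)

/-- `A` and `ℓ` contain, for every `m < ℓ` in `S`, the witness for `T ⟨m⟩ = 0`, and `A` mentions
no successor of `⟨m⟩` with `m ≥ ℓ`. -/
structure IsWindow (S : Set ℕ) (A : Finset (List ℕ)) (ℓ : ℕ) (z : LabelledPoint) : Prop where
  mem : ∀ m < ℓ, [m] ∈ A
  lt : ∀ m j : ℕ, [m, j] ∈ A → m < ℓ
  witness : ∀ m < ℓ, m ∈ S → ∃ k : ℕ, z.1 [m, k] = true ∧ (∀ j < k, z.1 [m, j] = false) ∧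
    ∀ j ≤ k, [m, j] ∈ A

section Coherent

variable {J : ℕ → ℕ} {M : ℕ → ℕ → Bool} {S : Set ℕ} {z : LabelledPoint}

theorem coherent_child_eq_false (hz : z ∈ coherentPoints J M S) {σ : List ℕ}
    (h : z.1 σ = true) (k : ℕ) : z.1 (σ ++ [k]) = false := (hz.1 σ).1 h k

theorem coherent_eq_false_iff (hz : z ∈ coherentPoints J M S) (σ : List ℕ) :
    z.1 σ = false ↔ ∃ k : ℕ, z.1 (σ ++ [k]) = true := by
  rw [← not_iff_not, Bool.not_eq_false, hz.1 σ]
  simp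

theorem coherent_short_eq {w : LabelledPoint} (hz : z ∈ coherentPoints J M S)
    (hw : w ∈ coherentPoints J M S) {σ : List ℕ} (hσ : σ.length < 2) : w.1 σ = z.1 σ := by
  have h1 : ∀ m : ℕ, w.1 [m] = z.1 [m] := fun m => by
    have := (hz.2.1 m).trans (hw.2.1 m).symm
    cases h : w.1 [m] <;> simp_all
  match σ, hσ with
  | [m], _ => exact h1 m
  | [], _ =>
    rw [Bool.eq_iff_iff, hz.1, hw.1]
    simp [h1]

theorem coherent_witness (hz : z ∈ coherentPoints J M S) {m : ℕ} (hm : m ∈ S) :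
    ∃ k : ℕ, z.1 [m, k] = true ∧ ∀ j < k, z.1 [m, j] = false := by
  classical
  have h : ∃ k : ℕ, z.1 [m, k] = true := (coherent_eq_false_iff hz [m]).1 ((hz.2.1 m).2 hm)
  exact ⟨Nat.find h, Nat.find_spec h, fun j hj => by simpa using Nat.find_min h hj⟩

theorem exists_isWindow (hz : z ∈ coherentPoints J M S) {V : Set LabelledPoint} (hV : IsOpen V)
    (hzV : z ∈ V) (b : ℕ) :
    ∃ (A : Finset (List ℕ)) (ℓ : ℕ), b ≤ ℓ ∧ IsWindow S A ℓ z ∧ cylinder A ℓ z ⊆ V := by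
  classical
  obtain ⟨U₁, U₂, hU₁, hU₂, hz₁, hz₂, hU⟩ := isOpen_prod_iff.1 hV z.1 z.2 hzV
  obtain ⟨I₁, u₁, hu₁, hI₁⟩ := isOpen_pi_iff.1 hU₁ z.1 hz₁
  obtain ⟨I₂, u₂, hu₂, hI₂⟩ := isOpen_pi_iff.1 hU₂ z.2 hz₂
  have hk : ∀ m : ℕ, ∃ k : ℕ, m ∈ S → z.1 [m, k] = true ∧ ∀ j < k, z.1 [m, j] = false := by
    intro m
    by_cases hm : m ∈ S
    · obtain ⟨k, hk⟩ := coherent_witness hz hm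
      exact ⟨k, fun _ => hk⟩
    · exact ⟨0, fun h => absurd h hm⟩
  choose k hk using hk
  -- Beyond every first entry in `I₁` and every coordinate in `I₂`.
  let ℓ : ℕ := b + (I₁.sup fun σ => σ.headI + 1) + (I₂.sup fun i => i + 1)
  let A : Finset (List ℕ) := I₁ ∪ (Finset.range ℓ).image (fun m => [m]) ∪
    (Finset.range ℓ).biUnion fun m => (Finset.range (k m + 1)).image fun j => [m, j]
  refine ⟨A, ℓ, by omega, ⟨fun m hm => ?_, fun m j hmj => ?_, fun m hm hmS => ?_⟩, ?_⟩
  · simp only [A, Finset.mem_union, Finset.mem_image, Finset.mem_range]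
    exact Or.inl (Or.inr ⟨m, hm, rfl⟩)
  · simp only [A, Finset.mem_union, Finset.mem_image, Finset.mem_range, Finset.mem_biUnion] at hmj
    rcases hmj with (h | ⟨a, _, h⟩) | ⟨a, ha, b, _, h⟩
    · have : m + 1 ≤ I₁.sup fun σ => σ.headI + 1 :=
        Finset.le_sup (f := fun σ : List ℕ => σ.headI + 1) h
      omega
    · simp at h
    · simp only [List.cons.injEq, and_true] at h
      omega
  · refine ⟨k m, (hk m hmS).1, (hk m hmS).2, fun j hj => ?_⟩
    simp only [A, Finset.mem_union, Finset.mem_image, Finset.mem_range, Finset.mem_biUnion]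
    exact Or.inr ⟨m, hm, j, by omega, rfl⟩
  · intro w hw
    refine hU ⟨hI₁ fun σ hσ => ?_, hI₂ fun i hi => ?_⟩
    · rw [hw.1 σ (by simp only [A, Finset.mem_union]; exact Or.inl (Or.inl hσ))]
      exact (hu₁ σ hσ).2
    · have : i + 1 ≤ I₂.sup fun i => i + 1 := Finset.le_sup (f := fun i : ℕ => i + 1) hi
      rw [hw.2 i (by omega)]
      exact (hu₂ i hi).2

end Coherent

/-! ### Transfer of information up to a rank, and amalgamation -/

section Transfer

variable {α : Ordinal.{0}} (F : LadderSystem α)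

/-- The part of level `γ` of the information that `A` and `ℓ` contain about `z` holds for `w`. -/
def Transfers (γ : Ordinal.{0}) (A : Finset (List ℕ)) (ℓ : ℕ) (z w : LabelledPoint) : Prop :=
  (∀ σ ∈ A, z.1 σ = true → F.rank σ ≤ γ → w.1 σ = true) ∧
  (∀ σ ∈ A, z.1 σ = false → (F.rank σ < γ ∨ F.rank σ = 0) → w.1 σ = false) ∧
  (∀ σ ∈ A, z.1 σ = true → γ < F.rank σ → ∀ k : ℕ, F.rank (σ ++ [k]) < γ →
    w.1 (σ ++ [k]) = false) ∧
  ∀ i < ℓ, w.2 i = z.2 i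

/-- The clause on all children of small rank is still open: a node of rank above `γ` has only
finitely many children of rank below `γ`. -/
theorem isOpen_transfers (γ : Ordinal.{0}) (A : Finset (List ℕ)) (ℓ : ℕ) (z : LabelledPoint) :
    IsOpen {w | F.Transfers γ A ℓ z w} := by
  have : {w | F.Transfers γ A ℓ z w} =
      (⋂ σ ∈ A, {w | z.1 σ = true → F.rank σ ≤ γ → w.1 σ = true}) ∩
      ((⋂ σ ∈ A, {w | z.1 σ = false → (F.rank σ < γ ∨ F.rank σ = 0) → w.1 σ = false}) ∩
      ((⋂ σ ∈ A, {w | z.1 σ = true → γ < F.rank σ → ∀ k ∈ {k : ℕ | F.rank (σ ++ [k]) < γ},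
        w.1 (σ ++ [k]) = false}) ∩
      ⋂ i ∈ Finset.range ℓ, {w : LabelledPoint | w.2 i = z.2 i})) := by
    ext w; simp [Transfers]
  have himp : ∀ {p : Prop} {f : LabelledPoint → Prop}, (p → IsOpen {w | f w}) →
      IsOpen {w | p → f w} := by
    intro p f h
    by_cases hp : p
    · simpa [hp] using h hp
    · simp [hp]
  rw [this]
  refine .inter ?_ (.inter ?_ (.inter ?_ ?_))
  · exact isOpen_biInter_finset fun σ _ => himp fun _ => himp fun _ =>
      (isClopen_setOf_fst_eq _ _).isOpen
  · exact isOpen_biInter_finset fun σ _ => himp fun _ => himp fun _ =>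
      (isClopen_setOf_fst_eq _ _).isOpen
  · refine isOpen_biInter_finset fun σ _ => himp fun _ => himp fun hσ => ?_
    have : {w : LabelledPoint | ∀ k ∈ {k : ℕ | F.rank (σ ++ [k]) < γ}, w.1 (σ ++ [k]) = false} =
        ⋂ k ∈ {k : ℕ | F.rank (σ ++ [k]) < γ}, {w : LabelledPoint | w.1 (σ ++ [k]) = false} := by
      ext w; simp
    rw [this]
    exact (F.finite_rank_child_lt hσ).isOpen_biInter fun k _ => (isClopen_setOf_fst_eq _ _).isOpen
  · exact isOpen_biInter_finset fun i _ => (isClopen_setOf_snd_eq _ _).isOpen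

variable {F}

theorem Transfers.child_eq_false {γ : Ordinal.{0}} {A : Finset (List ℕ)} {ℓ : ℕ}
    {z w : LabelledPoint} {J : ℕ → ℕ} {M : ℕ → ℕ → Bool} {S : Set ℕ}
    (h : F.Transfers γ A ℓ z w) (hw : w ∈ coherentPoints J M S) {σ : List ℕ} (hσ : σ ∈ A)
    (hz : z.1 σ = true) (k : ℕ) (hk : F.rank (σ ++ [k]) < γ) : w.1 (σ ++ [k]) = false := by
  by_cases hr : F.rank σ ≤ γ
  · exact coherent_child_eq_false hw (h.1 σ hσ hz hr) k
  · exact h.2.2.1 σ hσ hz (not_le.1 hr) k hk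

/-- Amalgamation of a window around `z` with the part of lower level of a window around a point
`w` to which the window around `z` transfers. -/
theorem exists_amalgam {J : ℕ → ℕ} {M : ℕ → ℕ → Bool} (hM : DenseRange M) {S S' : Set ℕ} {n : ℕ}
    {γ γ' : Ordinal.{0}} (hγα : γ < α) (hγ : γ' < γ) (hn : ∀ m ≥ n, γ ≤ F.rank [m])
    (h0 : ∀ m : ℕ, F.rank [m] ≠ 0) (hS : ∀ m < n, m ∈ S) (hS' : ∀ m < n, m ∈ S')
    {z w : LabelledPoint} (hz : z ∈ coherentPoints J M S) (hw : w ∈ coherentPoints J M S')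
    {A : Finset (List ℕ)} {ℓ : ℕ} (hA : IsWindow S A ℓ z) (hzw : F.Transfers γ A ℓ z w)
    (hw₁ : ∀ m ∉ S, ∀ j : ℕ, w.1 [m, j] = true → γ ≤ F.rank [m, j])
    (hw₂ : ∀ m ∈ S, ℓ ≤ m → ∀ j : ℕ, w.1 [m, j] = false)
    (A' : Finset (List ℕ)) (ℓ' : ℕ) :
    ∃ v ∈ coherentPoints J M S, v ∈ cylinder A ℓ z ∧ F.Transfers γ' A' ℓ' w v := by
  have hroot : F.rank [] = α := rfl
  -- Clashes between the data from `z` and from `w` are excluded because `w` satisfies the level-`γ`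
  -- data of `z`, while only data of the lower level `γ'` are taken from `w`.
  let Q₁ : Set (List ℕ) := {σ | 2 ≤ σ.length ∧ ((σ ∈ A ∧ z.1 σ = true) ∨
    (σ ∈ A' ∧ w.1 σ = true ∧ F.rank σ ≤ γ'))}
  let Q₀ : Set (List ℕ) := {σ | (σ ∈ A ∧ z.1 σ = false) ∨
    (σ ∈ A' ∧ w.1 σ = false ∧ (F.rank σ < γ' ∨ F.rank σ = 0)) ∨
    (∃ τ ∈ A', ∃ k : ℕ, σ = τ ++ [k] ∧ w.1 τ = true ∧ F.rank σ < γ')}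
  have htf : ∀ {b : Bool}, b = true → b = false → False := by simp
  have hw₀ : ∀ σ ∈ Q₀, (σ ∈ A ∧ z.1 σ = false) ∨
      (w.1 σ = false ∧ (F.rank σ < γ' ∨ F.rank σ = 0)) := by
    rintro σ (h | h | ⟨τ, hτ, k, rfl, hτw, hr⟩)
    · exact Or.inl h
    · exact Or.inr h.2
    · exact Or.inr ⟨coherent_child_eq_false hw hτw k, Or.inl hr⟩
  obtain ⟨v, hv, hvy, hv₁, hv₀⟩ := exists_coherentPoint (J := J) hM (S := S) (Q₁ := Q₁) (Q₀ := Q₀)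
    w.2 (fun σ h => h.1) (by
      rintro σ ⟨-, h₁⟩ h₀
      rcases hw₀ σ h₀ with h₀ | ⟨h₀, hr⟩
      · rcases h₁ with h₁ | ⟨-, h₁, hr⟩
        · exact htf h₁.2 h₀.2
        · exact htf h₁ (hzw.2.1 σ h₀.1 h₀.2 (Or.inl (hr.trans_lt hγ)))
      · rcases h₁ with h₁ | ⟨-, h₁, -⟩
        · refine htf (hzw.1 σ h₁.1 h₁.2 ?_) h₀
          rcases hr with hr | hr
          · exact (hr.trans hγ).le
          · rw [hr]; exact zero_le
        · exact htf h₁ h₀) (by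
      rintro σ ⟨-, h⟩ k ⟨-, hk⟩
      rcases h with h | ⟨-, h, hr⟩
      · rcases hk with hk | ⟨-, hk, hr⟩
        · exact htf hk.2 (coherent_child_eq_false hz h.2 k)
        · exact htf hk (hzw.child_eq_false hw h.1 h.2 k (hr.trans_lt hγ))
      · have hk0 := coherent_child_eq_false hw h k
        rcases hk with hk | ⟨-, hk, -⟩
        · refine htf (hzw.1 _ hk.1 hk.2 (le_trans ?_ (hr.trans hγ.le))) hk0
          rw [rank_append]
          exact F.childRank_le (F.rank_le σ) k
        · exact htf hk hk0) (by
      refine (A ∪ A').finite_toSet.subset ?_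
      rintro σ ⟨-, h | h⟩ <;> simp [h.1]) (by
      intro σ hσ hσQ
      have hf : ∀ B : Finset (List ℕ), {k : ℕ | σ ++ [k] ∈ B}.Finite := fun B =>
        (finite_setOf_append_mem B.finite_toSet σ).subset fun k hk => ⟨[], hk⟩
      have hf' : {k : ℕ | σ ∈ A' ∧ w.1 σ = true ∧ F.rank (σ ++ [k]) < γ'}.Finite := by
        by_cases hr : γ' < F.rank σ
        · exact (F.finite_rank_child_lt hr).subset fun k hk => hk.2.2
        -- A node with label 1 and rank at most `γ'` lies in `Q₁` if its length is at least 2; at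
        -- length 1 the label rules out `m < n` and the rank rules out `m ≥ n`.
        · convert finite_empty (α := ℕ)
          ext k
          simp only [mem_ofPred_eq, mem_empty_iff_false, iff_false]
          rintro ⟨hσA, hσw, -⟩
          match σ, hσ with
          | [m], _ =>
            by_cases hm : m < n
            · exact htf hσw ((hw.2.1 m).2 (hS' m hm))
            · exact hr (hγ.trans_le (hn m (not_lt.1 hm)))
          | a :: b :: l, _ => exact hσQ ⟨by simp, Or.inr ⟨hσA, hσw, not_lt.1 hr⟩⟩
      refine ((hf A).union ((hf A').union hf')).subset ?_
      rintro k (h | h | ⟨τ, hτ, k', h, hτw, hr⟩)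
      · exact Or.inl h.1
      · exact Or.inr (Or.inl h.1)
      · obtain ⟨rfl, -⟩ := List.append_inj' h rfl
        exact Or.inr (Or.inr ⟨hτ, hτw, hr⟩)) (by
      rintro m j ⟨-, h | ⟨-, h, hr⟩⟩
      · by_contra hm
        refine htf h.2 (coherent_child_eq_false hz (σ := [m]) ?_ j)
        by_contra hm'
        exact hm ((hz.2.1 m).1 (by simpa using hm'))
      · by_contra hm
        exact absurd (hw₁ m hm j h) (not_le.2 (hr.trans_lt hγ))) (by
      intro m hm
      by_cases hmℓ : m < ℓ
      · obtain ⟨k, hk, hkj, hkA⟩ := hA.witness m hmℓ hm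
        refine Or.inl ⟨k, ⟨by simp, Or.inl ⟨hkA k le_rfl, hk⟩⟩,
          fun j hj => Or.inl ⟨hkA j hj.le, hkj j hj⟩, ?_, fun i hi => ?_⟩
        · by_contra! hkJ
          exact htf hk (hz.2.2.1 m k hkJ)
        · rw [hzw.2.2.2 i (by omega)]
          exact hz.2.2.2 m k hk hkj i hi
      · refine Or.inr ?_
        rintro j ⟨-, h | h⟩
        · exact hmℓ (hA.lt m j h.1)
        · exact htf h.2.1 (hw₂ m hm (not_lt.1 hmℓ) j))
  refine ⟨v, hv, ⟨fun σ hσ => ?_, fun i hi => by rw [hvy]; exact hzw.2.2.2 i hi⟩,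
    fun σ hσ hσw hr => ?_, fun σ hσ hσw hr => ?_, fun σ hσ hσw hrσ k hr => ?_,
    fun i _ => by rw [hvy]⟩
  · by_cases hl : σ.length < 2
    · exact coherent_short_eq hz hv hl
    · cases h : z.1 σ
      · exact hv₀ σ (Or.inl ⟨hσ, h⟩) (not_lt.1 hl)
      · exact hv₁ σ ⟨not_lt.1 hl, Or.inl ⟨hσ, h⟩⟩
  · match σ with
    | [] => exact absurd (hr.trans_lt (hγ.trans hγα)) (by simp [hroot])
    | [m] =>
      by_cases hm : m < n
      · exact (htf hσw ((hw.2.1 m).2 (hS' m hm))).elim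
      · exact absurd (hr.trans_lt hγ) (not_lt.2 (hn m (not_lt.1 hm)))
    | a :: b :: l => exact hv₁ _ ⟨by simp, Or.inr ⟨hσ, hσw, hr⟩⟩
  · match σ with
    | [] =>
      rcases hr with hr | hr
      · exact absurd (hr.trans (hγ.trans hγα)) (by simp [hroot])
      · rw [hroot] at hr
        simp [hr] at hγα
    | [m] =>
      by_cases hm : m < n
      · exact (hv.2.1 m).2 (hS m hm)
      · rcases hr with hr | hr
        · exact absurd (hr.trans hγ) (not_lt.2 (hn m (not_lt.1 hm)))
        · exact absurd hr (h0 m)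
    | a :: b :: l => exact hv₀ _ (Or.inr (Or.inl ⟨hσ, hσw, hr⟩)) (by simp)
  · match σ with
    | [] =>
      by_cases hm : k < n
      · exact (hv.2.1 k).2 (hS k hm)
      · exact absurd (hr.trans hγ) (not_lt.2 (hn k (not_lt.1 hm)))
    | a :: l => exact hv₀ _ (Or.inr (Or.inr ⟨_, hσ, k, rfl, hσw, hr⟩)) (by simp)

end Transfer

end LadderSystem

/-! ### From total labellings to labellings of the leaves -/

namespace LadderSystem

variable {α : Ordinal.{0}} (F : LadderSystem α)

/-- The restriction of the labelling to the leaves of `T_α`. -/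
def toPoint (z : LabelledPoint) : F.Point := (fun σ => z.1 σ.1, z.2)

theorem continuous_toPoint : Continuous F.toPoint :=
  (continuous_pi fun σ => (continuous_apply σ.1).comp continuous_fst).prodMk continuous_snd

theorem exists_leaves_of_toPoint_mem {B : Set F.Point} (hB : IsOpen B) {w : LabelledPoint}
    (hw : F.toPoint w ∈ B) : ∃ (A : Finset (List ℕ)) (ℓ : ℕ), (∀ σ ∈ A, F.rank σ = 0) ∧
      ∀ v ∈ cylinder A ℓ w, F.toPoint v ∈ B := by
  classical
  obtain ⟨U₁, U₂, hU₁, hU₂, hw₁, hw₂, hU⟩ := isOpen_prod_iff.1 hB _ _ hw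
  obtain ⟨I₁, u₁, hu₁, hI₁⟩ := isOpen_pi_iff.1 hU₁ _ hw₁
  obtain ⟨I₂, u₂, hu₂, hI₂⟩ := isOpen_pi_iff.1 hU₂ _ hw₂
  refine ⟨I₁.image fun σ => σ.1, I₂.sup fun i => i + 1, fun σ hσ => ?_, fun v hv =>
    hU ⟨hI₁ fun σ hσ => ?_, hI₂ fun i hi => ?_⟩⟩
  · obtain ⟨τ, -, rfl⟩ := Finset.mem_image.1 hσ
    exact τ.2.2
  · have : (F.toPoint v).1 σ = (F.toPoint w).1 σ :=
      hv.1 σ.1 (Finset.mem_image_of_mem (fun σ : F.Leaf => σ.1) hσ)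
    rw [this]
    exact (hu₁ σ hσ).2
  · have : i + 1 ≤ I₂.sup fun i => i + 1 := Finset.le_sup (f := fun i : ℕ => i + 1) hi
    have : (F.toPoint v).2 i = (F.toPoint w).2 i := hv.2 i (by omega)
    rw [this]
    exact (hu₂ i hi).2

section Coherent

variable {J : ℕ → ℕ} {M : ℕ → ℕ → Bool} {S : Set ℕ} {z : LabelledPoint}

/-- On the tree, the rule and the labels of the leaves determine all labels, by induction on rank.
-/
theorem label_toPoint (hz : z ∈ coherentPoints J M S) {σ : List ℕ} (hσ : F.IsNode σ) :
    F.label (F.toPoint z).1 σ = z.1 σ := by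
  induction h : F.rank σ using WellFoundedLT.induction generalizing σ with
  | ind β ih =>
    subst h
    by_cases h : F.rank σ = 0
    · exact F.label_leaf (F.toPoint z).1 ⟨σ, hσ, h⟩
    · have : F.label (F.toPoint z).1 σ = false ↔ z.1 σ = false := by
        rw [F.label_eq_false_iff _ h, coherent_eq_false_iff hz]
        exact exists_congr fun k => by rw [ih _ (F.rank_child_lt h k) (hσ.child k h) rfl]
      cases h' : z.1 σ <;> simp_all

theorem isNode_singleton (h : F.rank [] ≠ 0) (m : ℕ) : F.IsNode [m] := .child m .root h

theorem toPoint_mem_setW (h0 : F.rank [] ≠ 0) (h1 : ∀ m : ℕ, F.rank [m] ≠ 0)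
    (hz : z ∈ coherentPoints J M S) : F.toPoint z ∈ F.setW M := by
  intro m hm i hi
  have hlabel : F.label (F.toPoint z).1 [m] = false := by
    simp only [nx, lt_iSup_iff] at hm
    obtain ⟨n, hn, hmn⟩ := hm
    exact hn m (by exact_mod_cast hmn)
  have hnode : ∀ k : ℕ, F.IsNode [m, k] := fun k => (F.isNode_singleton h0 m).child k (h1 m)
  rw [F.label_toPoint hz (F.isNode_singleton h0 m)] at hlabel
  obtain ⟨k, hk⟩ := coherent_witness hz ((hz.2.1 m).1 hlabel)
  have hkx : F.kx (F.toPoint z).1 m = k := by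
    have : IsLeast {k : ℕ | F.label (F.toPoint z).1 [m, k] = true} k := by
      simp only [F.label_toPoint hz (hnode _)]
      refine ⟨hk.1, fun j hj => ?_⟩
      by_contra! hjk
      have h' : z.1 [m, j] = true := hj
      simp [hk.2 j hjk] at h'
    exact this.csInf_eq
  rw [hkx]
  exact hz.2.2.2 m k hk.1 hk.2 i (by omega)

end Coherent

/-! ### Retagging -/

section Forcing

variable {F} {J : ℕ → ℕ} {M : ℕ → ℕ → Bool}

/-- If a window around `z` forces the complement of a `Σ⁰_γ` set, then so does its part of
level `γ`, also when the set of the `m` with `T ⟨m⟩ = 0` is changed from all of `ℕ` to an initial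
segment or conversely. -/
theorem forcesOn_transfers (hM : DenseRange M) (h1 : ∀ m : ℕ, F.rank [m] ≠ 0)
    (hJ : ∀ γ : Ordinal.{0}, Order.succ γ < α →
      ∃ N : ℕ, ∀ m ≥ N, ∀ j ≥ J m, γ ≤ F.rank [m, j])
    (n : ℕ) {γ : Ordinal.{0}} {B : Set F.Point} (hB : SigmaZero γ B) (hγ : γ < α)
    (hn : ∀ m ≥ n, γ ≤ F.rank [m]) {S S' : Set ℕ} {A : Finset (List ℕ)} {ℓ : ℕ}
    {z : LabelledPoint} (hz : z ∈ coherentPoints J M S) (hA : IsWindow S A ℓ z) (hnℓ : n ≤ ℓ)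
    (hS : (S = univ ∧ S' = Iio n) ∨
      ((S = Iio n ∧ S' = univ) ∧ ∀ m ≥ ℓ, ∀ j ≥ J m, γ ≤ F.rank [m, j]))
    (h : ForcesOn (coherentPoints J M S) (cylinder A ℓ z) (F.toPoint ⁻¹' Bᶜ)) :
    ForcesOn (coherentPoints J M S') {w | F.Transfers γ A ℓ z w} (F.toPoint ⁻¹' Bᶜ) := by
  have amalgam : ∀ {γ γ' : Ordinal.{0}} {S S' : Set ℕ} {A : Finset (List ℕ)} {ℓ : ℕ}
      {z w : LabelledPoint}, γ < α → (∀ m ≥ n, γ ≤ F.rank [m]) → z ∈ coherentPoints J M S →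
      IsWindow S A ℓ z → n ≤ ℓ → ((S = univ ∧ S' = Iio n) ∨
        ((S = Iio n ∧ S' = univ) ∧ ∀ m ≥ ℓ, ∀ j ≥ J m, γ ≤ F.rank [m, j])) →
      w ∈ coherentPoints J M S' → F.Transfers γ A ℓ z w → γ' < γ →
      ∀ (A' : Finset (List ℕ)) (ℓ' : ℕ),
        ∃ v ∈ coherentPoints J M S, v ∈ cylinder A ℓ z ∧ F.Transfers γ' A' ℓ' w v := by
    intro γ γ' S S' A ℓ z w hγ hn hz hA hnℓ hS hw hzw hγ' A' ℓ'
    refine exists_amalgam hM hγ hγ' hn h1 ?_ ?_ hz hw hA hzw ?_ ?_ A' ℓ'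
    · rcases hS with ⟨rfl, rfl⟩ | ⟨⟨rfl, rfl⟩, -⟩ <;> simp
    · rcases hS with ⟨rfl, rfl⟩ | ⟨⟨rfl, rfl⟩, -⟩ <;> simp
    · intro m hm j hwj
      rcases hS with ⟨rfl, rfl⟩ | ⟨⟨rfl, rfl⟩, htail⟩
      · exact absurd (mem_univ m) hm
      · by_contra! hr
        by_cases hmℓ : m < ℓ
        · have hzm : z.1 [m] = true := by
            by_contra hzm
            exact hm ((hz.2.1 m).1 (by simpa using hzm))
          have := hzw.child_eq_false hw (hA.mem m hmℓ) hzm j hr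
          exact absurd (hwj.symm.trans this) (by simp)
        -- Outside the window, `J` excludes the early children, and the others have rank at least
        -- `γ`.
        · refine absurd (htail m (not_lt.1 hmℓ) j ?_) (not_le.2 hr)
          by_contra! hj
          exact absurd (hwj.symm.trans (hw.2.2.1 m j hj)) (by simp)
    · intro m hm hmℓ j
      rcases hS with ⟨rfl, rfl⟩ | ⟨⟨rfl, rfl⟩, -⟩
      · refine coherent_child_eq_false hw (σ := [m]) ?_ j
        by_contra hwm
        exact absurd ((hw.2.1 m).1 (by simpa using hwm)) (not_lt.2 (hnℓ.trans hmℓ))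
      · exact absurd hm (not_lt.2 (hnℓ.trans hmℓ))
  induction hB generalizing S S' A ℓ z with
  | @ofOpen B hB =>
    refine Eventually.of_forall fun w hzw hwB => ?_
    obtain ⟨A', ℓ', hA', hAB⟩ := F.exists_leaves_of_toPoint_mem hB hwB
    -- Level 0 suffices: it contains the labels of leaves, and these together with finitely many
    -- bits of `y` secure membership in `B`.
    obtain ⟨v, hv, hvz, hwv⟩ := amalgam hγ hn hz hA hnℓ hS w.2 hzw zero_lt_one A' ℓ'
    have hvB : F.toPoint v ∈ B := by
      refine hAB v ⟨fun σ hσ => ?_, hwv.2.2.2⟩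
      cases hwσ : (w : LabelledPoint).1 σ
      · exact hwv.2.1 σ hσ hwσ (Or.inr (hA' σ hσ))
      · exact hwv.1 σ hσ hwσ (hA' σ hσ).le
    obtain ⟨x, -, -, hx, hx'⟩ := ForcesOn.exists_mem_inter (D := F.toPoint ⁻¹' Bᶜ)
      (E := F.toPoint ⁻¹' B) (h.mono_left (V := cylinder A ℓ z ∩ F.toPoint ⁻¹' B)
        (inter_subset_left.trans inter_subset_left))
      (Eventually.of_forall fun x hx => hx.2)
      ((isOpen_cylinder A ℓ z).inter (hB.preimage F.continuous_toPoint)) ⟨v, ⟨hvz, hvB⟩, hv⟩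
    exact hx hx'
  | @iUnion γ β B hβ hB ih =>
    by_contra hnot
    rw [compl_iUnion, preimage_iInter] at hnot
    obtain ⟨i, hi⟩ := ForcesOn.exists_not_of_not_iInter hnot
    rw [preimage_compl] at hi
    have hBi : BaireMeasurableSet
        (Subtype.val ⁻¹' (F.toPoint ⁻¹' B i) : Set (coherentPoints J M S')) :=
      .of_compl ((hB i).preimage
        (F.continuous_toPoint.comp continuous_subtype_val)).baireMeasurableSet
    -- Some window around a `w` meeting the level-`γ` condition forces `B i`. By induction its
    -- level-`β i` part forces `B i` back in the space of `S`, and the amalgam makes this compatible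
    -- with the cylinder around `z`, which forces the complement of the union.
    obtain ⟨V, hVT, hV, ⟨w, hwV, hw⟩, hVB⟩ :=
      ForcesOn.exists_open_of_not_compl (F.isOpen_transfers γ A ℓ z) hBi hi
    have hβα : Order.succ (β i) < α := (Order.succ_le_of_lt (hβ i)).trans_lt hγ
    obtain ⟨N, hN⟩ := hJ (β i) hβα
    obtain ⟨A', ℓ', hℓ', hA', hAV⟩ := exists_isWindow hw hV hwV (max n N)
    obtain ⟨v, hv, hvz, hwv⟩ := amalgam hγ hn hz hA hnℓ hS hw (hVT hwV) (hβ i) A' ℓ'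
    have hf := ih i ((hβ i).trans hγ) (fun m hm => (hβ i).le.trans (hn m hm)) hw hA'
      ((le_max_left _ _).trans hℓ') (S' := S) (by
        have htail : ∀ m ≥ ℓ', ∀ j ≥ J m, β i ≤ F.rank [m, j] := fun m hm =>
          hN m (((le_max_right _ _).trans hℓ').trans hm)
        rcases hS with ⟨rfl, rfl⟩ | ⟨⟨rfl, rfl⟩, -⟩
        · exact Or.inr ⟨⟨rfl, rfl⟩, htail⟩
        · exact Or.inl ⟨rfl, rfl⟩) (by
        rw [compl_compl]
        exact hVB.mono_left (inter_subset_left.trans hAV))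
    obtain ⟨x, -, -, hx, hx'⟩ := ForcesOn.exists_mem_inter
      (h.mono_left (V := cylinder A ℓ z ∩ {x | F.Transfers (β i) A' ℓ' w x})
        (inter_subset_left.trans inter_subset_left))
      (hf.mono_left (inter_subset_left.trans inter_subset_right))
      ((isOpen_cylinder A ℓ z).inter (F.isOpen_transfers (β i) A' ℓ' w)) ⟨v, ⟨hvz, hwv⟩, hv⟩
    rw [compl_compl] at hx'
    exact hx (mem_iUnion.2 ⟨i, hx'⟩)

/-- This makes the transferred condition nonempty, so that category can be applied to it in the
space of `Iio n`. -/
theorem exists_transfers (hM : DenseRange M) (h1 : ∀ m : ℕ, F.rank [m] ≠ 0) {n : ℕ}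
    {γ : Ordinal.{0}} (hγ : γ < α) (hn : ∀ m ≥ n, γ ≤ F.rank [m]) {A : Finset (List ℕ)}
    {z : LabelledPoint} (hz : z ∈ coherentPoints J M univ) (hA : IsWindow univ A n z) :
    ∃ w ∈ coherentPoints J M (Iio n), F.Transfers γ A n z w := by
  have hroot : F.rank [] = α := rfl
  have htf : ∀ {b : Bool}, b = true → b = false → False := by simp
  obtain ⟨w, hw, hwy, hw₁, hw₀⟩ := exists_coherentPoint (J := J) hM (S := Iio n)
    (Q₁ := {σ | 2 ≤ σ.length ∧ σ ∈ A ∧ z.1 σ = true}) (Q₀ := {σ | σ ∈ A ∧ z.1 σ = false}) z.2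
    (fun σ h => h.1) (fun σ h h' => htf h.2.2 h'.2)
    (fun σ h k h' => htf h'.2.2 (coherent_child_eq_false hz h.2.2 k))
    (A.finite_toSet.subset fun σ h => h.2.1)
    (fun σ _ _ => (finite_setOf_append_mem A.finite_toSet σ).subset fun k hk => ⟨[], hk.1⟩)
    (fun m j h => hA.lt m j h.2.1) (fun m hm => by
      obtain ⟨k, hk, hkj, hkA⟩ := hA.witness m hm (mem_univ m)
      refine Or.inl ⟨k, ⟨by simp, hkA k le_rfl, hk⟩, fun j hj => ⟨hkA j hj.le, hkj j hj⟩, ?_,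
        hz.2.2.2 m k hk hkj⟩
      by_contra! hkJ
      exact htf hk (hz.2.2.1 m k hkJ))
  refine ⟨w, hw, fun σ hσ hσz hr => ?_, fun σ hσ hσz hr => ?_, fun σ hσ hσz hrσ k hr => ?_,
    fun i _ => by rw [hwy]⟩
  · match σ with
    | [] => exact absurd (hr.trans_lt hγ) (by simp [hroot])
    | [m] => exact (htf hσz ((hz.2.1 m).2 (mem_univ m))).elim
    | a :: b :: l => exact hw₁ _ ⟨by simp, hσ, hσz⟩
  · match σ with
    | [] =>
      rcases hr with hr | hr
      · exact absurd (hr.trans hγ) (by simp [hroot])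
      · rw [hroot] at hr
        simp [hr] at hγ
    | [m] =>
      by_cases hm : m < n
      · exact (hw.2.1 m).2 hm
      · rcases hr with hr | hr
        · exact absurd hr (not_lt.2 (hn m (not_lt.1 hm)))
        · exact absurd hr (h1 m)
    | a :: b :: l => exact hw₀ _ ⟨hσ, hσz⟩ (by simp)
  · match σ with
    | [] =>
      by_cases hm : k < n
      · exact (hw.2.1 k).2 hm
      · exact absurd hr (not_lt.2 (hn k (not_lt.1 hm)))
    | [m] => exact (htf hσz ((hz.2.1 m).2 (mem_univ m))).elim
    | a :: b :: l =>
      exact coherent_child_eq_false hw (hw₁ _ ⟨by simp, hσ, hσz⟩) k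

end Forcing

/-- Membership of `n` in the second coordinate is reversed. -/
def flip (n : ℕ) (z : LabelledPoint) : LabelledPoint :=
  (z.1, Function.update z.2 n (!z.2 n))

theorem flip_involutive (n : ℕ) : Function.Involutive (flip n) := by
  intro z
  simp [flip]

theorem continuous_flip (n : ℕ) : Continuous (flip n) := by
  have : Continuous fun z : LabelledPoint => !z.2 n :=
    (continuous_of_discreteTopology (f := not)).comp
      ((continuous_apply (A := fun _ : ℕ => Bool) n).comp continuous_snd)
  exact continuous_fst.prodMk (continuous_snd.update n this)

/-- Only the `m < n` have a witness, and they constrain `y` only up to `m`, hence never at `n`. -/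
theorem flip_mem_coherentPoints {J : ℕ → ℕ} {M : ℕ → ℕ → Bool} {n : ℕ} {z : LabelledPoint}
    (hz : z ∈ coherentPoints J M (Iio n)) : flip n z ∈ coherentPoints J M (Iio n) := by
  refine ⟨hz.1, hz.2.1, hz.2.2.1, fun m k hk hkj i hi => ?_⟩
  have hm : m < n := by
    refine (hz.2.1 m).1 ?_
    rw [coherent_eq_false_iff hz]
    exact ⟨k, hk⟩
  rw [← hz.2.2.2 m k hk hkj i hi]
  exact Function.update_of_ne (by omega) _ _

theorem graphK_adj_flip {J : ℕ → ℕ} {M : ℕ → ℕ → Bool} {n : ℕ} {z : LabelledPoint}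
    (h0 : F.rank [] ≠ 0) (hz : z ∈ coherentPoints J M (Iio n)) (hzn : z.2 n = false) :
    F.graphK.Adj (F.toPoint z) (F.toPoint (flip n z)) := by
  have hone : ∀ m : ℕ, z.1 [m] = true ↔ n ≤ m := fun m => by
    rw [← Bool.not_eq_false, hz.2.1 m, mem_Iio, not_lt]
  refine ⟨rfl, ?_, n, ?_, ?_, ?_⟩
  · rw [F.label_toPoint hz .root, coherent_eq_false_iff hz]
    exact ⟨n, (hone n).2 le_rfl⟩
  · simp only [F.label_toPoint hz (F.isNode_singleton h0 _), hone]
    exact isLeast_Ici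
  · ext i
    by_cases hi : i = n
    · subst hi
      simp [toPoint, flip, mem_symmDiff, hzn]
    · simp [toPoint, flip, mem_symmDiff, hi]
  · simp [toPoint, hzn]

end LadderSystem

/-! ### The monochromatic edge -/

open LadderSystem in
theorem mainTheorem5 (α : Ordinal.{0}) (hα : 3 ≤ α) (hα' : α < ω₁)
    (F : LadderSystem α)
    (hF : ∀ σ : List ℕ, F.IsNode σ → σ.length ≤ 2 → F.rank σ ≠ 0)
    (M : ℕ → ℕ → Bool) (hM : DenseRange M) :
    ¬ HasCountableSigmaColouring α (F.graphL M) := by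
  rintro ⟨c, hc, hcα⟩
  have h0 : F.rank [] ≠ 0 := hF [] .root (by simp)
  have h1 : ∀ m : ℕ, F.rank [m] ≠ 0 := fun m =>
    hF [m] (F.isNode_singleton h0 m) (by simp)
  obtain ⟨J, hJ⟩ := F.exists_uniform_le_rank
  have hW : ∀ {S : Set ℕ} {z : LabelledPoint}, z ∈ coherentPoints J M S →
      F.toPoint z ∈ F.setW M := fun hz => F.toPoint_mem_setW h0 h1 hz
  have hpieces : ∀ i : ℕ, ∃ (β : ℕ → Ordinal.{0}) (A : ℕ → Set F.Point), (∀ j, β j < α) ∧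
      (∀ j, SigmaZero (β j) (A j)ᶜ) ∧ Subtype.val ⁻¹' (⋃ j, A j) = c ⁻¹' {i} := by
    intro i
    obtain ⟨B, hB, hBc⟩ := (hcα i).exists_preimage_val
    rw [← hBc]
    cases hB with
    | ofOpen hU =>
      exact absurd hα (by norm_num)
    | iUnion β A hβ hA => exact ⟨β, A, hβ, hA, rfl⟩
  choose β A hβ hA hAc using hpieces
  obtain ⟨z₀, hz₀, -⟩ := exists_coherentPoint (J := J) hM (S := univ) (Q₁ := ∅) (Q₀ := ∅)
    (fun _ => false) (by simp) (by simp) (by simp) (by simp) (by simp) (by simp) (by simp)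
  have hex : ∃ i j, ¬ ForcesOn (coherentPoints J M univ) univ (F.toPoint ⁻¹' A i j)ᶜ := by
    by_contra! hno
    have hall : ForcesOn (coherentPoints J M univ) univ ∅ := by
      filter_upwards [eventually_countable_forall.2 fun i =>
        eventually_countable_forall.2 (hno i)] with z hz _
      have hzc : (⟨F.toPoint z, hW z.2⟩ : F.setW M) ∈ c ⁻¹' {c ⟨F.toPoint z, hW z.2⟩} := rfl
      rw [← hAc] at hzc
      obtain ⟨j, hj⟩ := mem_iUnion.1 hzc
      exact hz _ j (mem_univ _) hj
    obtain ⟨z, -, -, hz, -⟩ := hall.exists_mem_inter hall isOpen_univ ⟨z₀, mem_univ _, hz₀⟩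
    exact hz
  obtain ⟨i, j, hij⟩ := hex
  have hBM : BaireMeasurableSet
      (Subtype.val ⁻¹' (F.toPoint ⁻¹' A i j) : Set (coherentPoints J M univ)) :=
    .of_compl ((hA i j).preimage
      (F.continuous_toPoint.comp continuous_subtype_val)).baireMeasurableSet
  obtain ⟨V, -, hV, ⟨z, hzV, hz⟩, hVA⟩ :=
    ForcesOn.exists_open_of_not_compl isOpen_univ hBM hij
  obtain ⟨N, hN⟩ := F.exists_le_rank_child (σ := []) (hβ i j)
  -- The length of the window becomes the coordinate to be flipped: it is the first one that the
  -- window leaves free.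
  obtain ⟨D, n, hNn, hD, hDV⟩ := exists_isWindow hz hV hzV N
  have hn : ∀ m ≥ n, β i j ≤ F.rank [m] := fun m hm => hN m (hNn.trans hm)
  have hforce := forcesOn_transfers hM h1 hJ n (hA i j) (hβ i j) hn hz hD le_rfl
    (Or.inl ⟨rfl, rfl⟩) (by
      rw [compl_compl]
      exact hVA.mono_left (inter_subset_left.trans hDV))
  rw [compl_compl] at hforce
  have hforce' := (hforce.preimage_of_involutive (continuous_flip n) (flip_involutive n)
    fun _ => flip_mem_coherentPoints).mono_left (V := {w | F.Transfers (β i j) D n z w})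
    fun w hw => ⟨hw.1.1, hw.1.2.1, hw.1.2.2.1, fun i hi => by
      rw [← hw.1.2.2.2 i hi]
      exact Function.update_of_ne hi.ne _ _⟩
  obtain ⟨w₀, hw₀, hw₀'⟩ := exists_transfers hM h1 (hβ i j) hn hz hD
  obtain ⟨w, hw, -, hwA, hwA'⟩ := hforce.exists_mem_inter hforce'
    (F.isOpen_transfers _ _ _ _) ⟨w₀, hw₀', hw₀⟩
  have hcol : ∀ {v : LabelledPoint} (hv : v ∈ coherentPoints J M (Iio n)),
      F.toPoint v ∈ A i j → c ⟨F.toPoint v, hW hv⟩ = i := by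
    intro v hv hvA
    have : (⟨F.toPoint v, hW hv⟩ : F.setW M) ∈ c ⁻¹' {i} := by
      rw [← hAc]
      exact mem_iUnion.2 ⟨j, hvA⟩
    exact this
  have hw' := flip_mem_coherentPoints hw
  cases hwn : w.2 n with
  | false =>
    exact hc ⟨F.toPoint w, hW hw⟩ ⟨F.toPoint (flip n w), hW hw'⟩
      (F.graphK_adj_flip h0 hw hwn) ((hcol hw hwA).trans (hcol hw' hwA').symm)
  | true =>
    have hadj := F.graphK_adj_flip h0 hw' (by simp [LadderSystem.flip, hwn])
    rw [flip_involutive n w] at hadj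
    exact hc ⟨F.toPoint (flip n w), hW hw'⟩ ⟨F.toPoint w, hW hw⟩ hadj
      ((hcol hw' hwA').trans (hcol hw hwA).symm)
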